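/- Let a finite multigraph $\Gamma$ (loops and parallel edges allowed) with vertex set $V$ and edge set $E\neq\emptyset$ be given, and turn it into a metric graph $G$ by identifying each edge $e$ with $[0,1]$, running from a vertex $e(0)$ to a vertex $e(1)$. Let $\Delta^{CK}$ be the operator $u=(u_e)_{e\in E}\mapsto (u_e'')_{e\in E}$ on $L^2(0,1;\mathbb C^E)$ whose domain consists of all $u\in H^2(0,1;\mathbb C^E)$ that are continuous in the vertices (there is $\varphi:V\to\mathbb C$ with $u_e(0)=\varphi(e(0))$ and $u_e(1)=\varphi(e(1))$ for all $e$) and satisfy the Kirchhoff condition $\sum_{e:\,e(1)=v}u_e'(1)-\sum_{e:\,e(0)=v}u_e'(0)=0$ at every vertex $v$. Say that $\Gamma_2$ is formed from $\Gamma_1$ by contractions of vertices if $\Gamma_2$ arises by identifying vertices of $\Gamma_1$ and keeping the edges (up to reversing their parametrization), edges that become parallel remaining distinct; an edge joining two distinct vertices that are identified becomes a loop, which may be either retained or discarded. **Proposition.** Let $\Gamma_1,\Gamma_2$ be connected finite multigraphs such that $\Gamma_2$ is formed from $\Gamma_1$ by contractions of vertices and has at least one edge. Then $-\Delta^{CK}$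 on the metric graph $G_i$ of $\Gamma_i$ has a lowest nontrivial (i.e. nonzero) eigenvalue $\lambda^{(i)}$ $(i=1,2)$, and $$0<\lambda^{(1)}\le\lambda^{(2)}.$$ Consequently, the heat equation under $CK$-conditions on $G_2$ converges to equilibrium at least as fast as the one on $G_1$. Precisely, say that the heat equation on $G$ converges at rate $\alpha\in\mathbb R$ if there is a constant $C$ such that $$\|u(t)-\bar u\|\le C e^{-\alpha t}\,\|u(0)-\bar u\|\qquad(t\ge0)$$ in $L^2(0,1;\mathbb C^E)$ for every continuous $u:[0,\infty)\to L^2(0,1;\mathbb C^E)$ that is differentiable on $(0,\infty)$ with $u(t)\in D(\Delta^{CK})$ and $u'(t)=\Delta^{CK}u(t)$ for $t>0$, where the equilibrium $\bar u$ is the constant function on $G$ whose value is the mean $\frac1{\# E}\sum_{e\in E}\int_0^1u_e(0)(x)\,dx$ of the initial value $u(0)=(u_e(0))_{e\in E}$. Then $\lambda^{(i)}$ is the greatest rate at which the heat equation on $G_i$ converges $(i=1,2)$, and every rate of convergence on $G_1$ is also a rate of convergence on $G_2$. -/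

import Mathlib

open MeasureTheory Set

noncomputable section

namespace CKHeat

/-- A multigraph (parallel edges and loops allowed) with vertex set `V` and edge set `E`. Each
edge `e` is identified with the unit interval `[0,1]`, running from `src e` (at `0`) to `tgt e`
(at `1`); this choice of a parametrization turns the graph into a metric graph. -/
structure Multigraph (V E : Type*) where
  src : E → V
  tgt : E → V

/-- Connectedness: `V` is nonempty and any two vertices are joined by a path (edges may be
traversed in both directions; loops are irrelevant). -/
def Multigraph.Connected {V E : Type*} (Γ : Multigraph V E) : Prop :=
  (SimpleGraph.fromRel (fun a b : V => ∃ e, Γ.src e = a ∧ Γ.tgt e = b)).Connected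

/-- `Γ₂` is formed from `Γ₁` by contractions of vertices: vertices of `Γ₁` are identified with each
other (through the surjection `p`, two vertices being identified when they have the same image),
and the edges are kept (through `i`, up to a reversal of the parametrization of an edge). In
particular edges that become parallel stay distinct. An edge joining two distinct vertices that are
identified becomes a loop, which may either be retained or be discarded. -/
def Multigraph.IsVertexContraction {V₁ E₁ V₂ E₂ : Type*}
    (Γ₁ : Multigraph V₁ E₁) (Γ₂ : Multigraph V₂ E₂) : Prop :=
  ∃ (p : V₁ → V₂) (i : E₂ → E₁), Function.Surjective p ∧ Function.Injective i ∧
    (∀ e : E₂,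
      (Γ₂.src e = p (Γ₁.src (i e)) ∧ Γ₂.tgt e = p (Γ₁.tgt (i e))) ∨
      (Γ₂.src e = p (Γ₁.tgt (i e)) ∧ Γ₂.tgt e = p (Γ₁.src (i e)))) ∧
    (∀ e : E₁, e ∉ Set.range i →
      Γ₁.src e ≠ Γ₁.tgt e ∧ p (Γ₁.src e) = p (Γ₁.tgt e))

/-- The Hilbert space `L²(0,1; ℂ^E)` of square integrable functions on the metric graph. -/
abbrev L2 (E : Type*) [Fintype E] : Type _ :=
  Lp (EuclideanSpace ℂ E) 2 (volume.restrict (Icc (0 : ℝ) 1))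

variable {V E : Type*} [Fintype E]

open Classical in
/-- The graph of the operator `Δ^CK`: `f` lies in the domain of `Δ^CK`, and `Δ^CK f = g`. That is,
`f` has a representative `F` in `H²(0,1; ℂ^E)` (so `F` is an antiderivative of `F'`, and `F'` one
of `g ∈ L²`, on `[0,1]`) which is continuous in the vertices (with vertex values `φ`) and satisfies
the Kirchhoff condition: at each vertex the outer normal derivatives sum up to zero. -/
def Multigraph.IsCKLaplacian (Γ : Multigraph V E) (f g : L2 E) : Prop :=
  ∃ F F' : ℝ → EuclideanSpace ℂ E,
    (f : ℝ → EuclideanSpace ℂ E) =ᵐ[volume.restrict (Icc (0 : ℝ) 1)] F ∧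
    (∀ x ∈ Icc (0 : ℝ) 1, F x = F 0 + ∫ s in (0 : ℝ)..x, F' s) ∧
    (∀ x ∈ Icc (0 : ℝ) 1, F' x = F' 0 + ∫ s in (0 : ℝ)..x, g s) ∧
    (∃ φ : V → ℂ, ∀ e : E, F 0 e = φ (Γ.src e) ∧ F 1 e = φ (Γ.tgt e)) ∧
    (∀ v : V, ∑ e : E,
      ((if Γ.tgt e = v then F' 1 e else 0) - (if Γ.src e = v then F' 0 e else 0)) = 0)

/-- `lam` is an eigenvalue of `-Δ^CK`. -/
def Multigraph.IsCKEigenvalue (Γ : Multigraph V E) (lam : ℝ) : Prop :=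
  ∃ f : L2 E, f ≠ 0 ∧ Γ.IsCKLaplacian f (-((lam : ℂ) • f))

/-- `lam` is the lowest nontrivial (i.e. nonzero) eigenvalue of `-Δ^CK`. -/
def Multigraph.IsLowestNontrivialCKEigenvalue (Γ : Multigraph V E) (lam : ℝ) : Prop :=
  IsLeast {l : ℝ | l ≠ 0 ∧ Γ.IsCKEigenvalue l} lam

/-- `u` solves the heat equation `u' = Δ^CK u` on `(0,∞)`, in the sense of the abstract Cauchy
problem in `L²(0,1; ℂ^E)`, with an arbitrary initial value `u 0` in this space. -/
def Multigraph.IsCKHeatSolution (Γ : Multigraph V E) (u : ℝ → L2 E) : Prop :=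
  ContinuousOn u (Ici 0) ∧
    ∀ t : ℝ, 0 < t → ∃ g : L2 E, HasDerivAt u g t ∧ Γ.IsCKLaplacian (u t) g

/-- The equilibrium that belongs to the initial value `f` on a connected metric graph: the constant
function on the metric graph whose value is the mean value of `f`. -/
def equilibrium (f : L2 E) : L2 E :=
  Lp.const 2 (volume.restrict (Icc (0 : ℝ) 1))
    (WithLp.toLp 2 (fun _ : E =>
      (Fintype.card E : ℂ)⁻¹ * ∑ e : E, ∫ x in (0 : ℝ)..1, (f : ℝ → EuclideanSpace ℂ E) x e))

/-- The solutions of the heat equation under the `CK`-condition converge to their equilibria at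
least at the exponential rate `α`, uniformly in the initial value. -/
def Multigraph.HeatConvergesAtRate (Γ : Multigraph V E) (α : ℝ) : Prop :=
  ∃ C : ℝ, ∀ u : ℝ → L2 E, Γ.IsCKHeatSolution u → ∀ t : ℝ, 0 ≤ t →
    ‖u t - equilibrium (u 0)‖ ≤ C * Real.exp (-α * t) * ‖u 0 - equilibrium (u 0)‖

end CKHeat

end

/-!
The Kirchhoff condition is the natural boundary condition of the quadratic form `f ↦ ‖f'‖²` on the
functions in `H¹` of the metric graph, i.e. those that are continuous in the vertices. Hence the
lowest nonzero eigenvalue of `-Δ^CK` is the optimal constant in the Poincaré inequality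
`lam * ‖f - equilibrium f‖² ≤ ‖f'‖²`. It is attained because the primitive of mean zero depends
compactly on the derivative, and it is the optimal rate of decay of `‖u t - equilibrium (u 0)‖`.
When `Γ₂` is formed from `Γ₁` by contractions of vertices, composition with the contraction turns an
`H¹` function on the metric graph of `Γ₂` into one on that of `Γ₁` with the same energy, whose
distance to each constant is at least as large. So the Poincaré inequality passes from `Γ₁` to `Γ₂`.
-/

noncomputable section

namespace CKHeat

open scoped InnerProductSpace

section UnitInterval

/-- The space `L²(0,1; X)`. -/
abbrev UnitL2 (X : Type*) [NormedAddCommGroup X] : Type _ :=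
  Lp X 2 (volume.restrict (Icc (0 : ℝ) 1))

section Primitive

variable {X : Type*} [NormedAddCommGroup X]

theorem UnitL2.integrableOn (f : UnitL2 X) : IntegrableOn f (Icc (0 : ℝ) 1) :=
  (Lp.memLp f).integrable one_le_two

theorem UnitL2.intervalIntegrable (f : UnitL2 X) {x y : ℝ} (hx : x ∈ Icc (0 : ℝ) 1)
    (hy : y ∈ Icc (0 : ℝ) 1) : IntervalIntegrable f volume x y :=
  (f.integrableOn.mono_set (ordConnected_Icc.uIcc_subset hx hy)).intervalIntegrable

variable [NormedSpace ℂ X]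

theorem intervalIntegral_congr_of_ae_Icc {f g : ℝ → X}
    (h : f =ᵐ[volume.restrict (Icc (0 : ℝ) 1)] g) {x : ℝ} (hx : x ∈ Icc (0 : ℝ) 1) :
    ∫ s in (0 : ℝ)..x, f s = ∫ s in (0 : ℝ)..x, g s := by
  rw [intervalIntegral.integral_of_le hx.1, intervalIntegral.integral_of_le hx.1]
  exact integral_congr_ae (ae_mono (Measure.restrict_mono
    (Ioc_subset_Icc_self.trans (Icc_subset_Icc_right hx.2)) le_rfl) h)

theorem UnitL2.norm_intervalIntegral_le (h : UnitL2 X) {x y : ℝ} (hx : x ∈ Icc (0 : ℝ) 1)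
    (hy : y ∈ Icc (0 : ℝ) 1) (hxy : x ≤ y) :
    ‖∫ s in x..y, h s‖ ≤ ‖h‖ * √(y - x) := by
  have hle : volume.restrict (Ioc x y) ≤ volume.restrict (Icc (0 : ℝ) 1) :=
    Measure.restrict_mono (Ioc_subset_Icc_self.trans (Icc_subset_Icc hx.1 hy.2)) le_rfl
  have holder : ‖∫ s in x..y, h s‖ₑ ≤
      eLpNorm h 2 (volume.restrict (Icc (0 : ℝ) 1)) * ENNReal.ofReal (y - x) ^ (1 / 2 : ℝ) := by
    rw [intervalIntegral.integral_of_le hxy]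
    refine (enorm_integral_le_lintegral_enorm _).trans ?_
    rw [← eLpNorm_one_eq_lintegral_enorm]
    refine (eLpNorm_le_eLpNorm_mul_rpow_measure_univ (q := 2) one_le_two
      ((Lp.aestronglyMeasurable h).mono_measure hle)).trans ?_
    refine mul_le_mul' (eLpNorm_mono_measure _ hle) (le_of_eq ?_)
    rw [Measure.restrict_apply_univ, Real.volume_Ioc]
    norm_num
  have := ENNReal.toReal_mono (ENNReal.mul_ne_top (Lp.eLpNorm_ne_top h)
    (ENNReal.rpow_ne_top_of_nonneg (by norm_num) ENNReal.ofReal_ne_top)) holder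
  rwa [ENNReal.toReal_mul, ← Lp.norm_def, ← ENNReal.toReal_rpow,
    ENNReal.toReal_ofReal (sub_nonneg.2 hxy), ← Real.sqrt_eq_rpow, toReal_enorm] at this

theorem UnitL2.norm_primitive_le (h : UnitL2 X) (x : Icc (0 : ℝ) 1) :
    ‖∫ s in (0 : ℝ)..x, h s‖ ≤ ‖h‖ := by
  refine (h.norm_intervalIntegral_le (by simp) x.2 x.2.1).trans
    (mul_le_of_le_one_right (norm_nonneg h) ?_)
  simpa using x.2.2

theorem UnitL2.dist_primitive_le (h : UnitL2 X) (x y : Icc (0 : ℝ) 1) :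
    dist (∫ s in (0 : ℝ)..x, h s) (∫ s in (0 : ℝ)..y, h s) ≤ ‖h‖ * √(dist x y) := by
  wlog hyx : y ≤ x generalizing x y
  · rw [dist_comm, dist_comm x]
    exact this y x (le_of_not_ge hyx)
  have hyx' : (y : ℝ) ≤ x := hyx
  rw [dist_eq_norm, intervalIntegral.integral_interval_sub_left
    (h.intervalIntegrable (by simp) x.2) (h.intervalIntegrable (by simp) y.2),
    Subtype.dist_eq, Real.dist_eq, abs_of_nonneg (sub_nonneg.2 hyx')]
  exact h.norm_intervalIntegral_le y.2 x.2 hyx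

theorem UnitL2.continuous_primitive (h : UnitL2 X) :
    Continuous fun x : Icc (0 : ℝ) 1 => ∫ s in (0 : ℝ)..x, h s := by
  have := intervalIntegral.continuousOn_primitive_interval (μ := volume) (f := h) (a := 0) (b := 1)
    (by simpa using h.integrableOn)
  rw [uIcc_of_le zero_le_one] at this
  exact this.domRestrict

open BoundedContinuousFunction in
/-- The primitive `x ↦ ∫₀ˣ h` of `h ∈ L²(0,1; X)`, as a continuous function. -/
def primitive : UnitL2 X →L[ℂ] (Icc (0 : ℝ) 1 →ᵇ X) :=
  LinearMap.mkContinuous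
    { toFun h := .mkOfCompact ⟨fun x => ∫ s in (0 : ℝ)..x, h s, h.continuous_primitive⟩
      map_add' f g := by
        ext x
        simp only [mkOfCompact_apply, ContinuousMap.coe_mk, BoundedContinuousFunction.coe_add,
          Pi.add_apply]
        rw [intervalIntegral_congr_of_ae_Icc (Lp.coeFn_add f g) x.2]
        exact intervalIntegral.integral_add (f.intervalIntegrable (by simp) x.2)
          (g.intervalIntegrable (by simp) x.2)
      map_smul' c f := by
        ext x
        simp only [mkOfCompact_apply, ContinuousMap.coe_mk, BoundedContinuousFunction.coe_smul,
          RingHom.id_apply]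
        rw [intervalIntegral_congr_of_ae_Icc (Lp.coeFn_smul c f) x.2]
        exact intervalIntegral.integral_smul c f }
    1 fun h => by
      rw [one_mul]
      exact (BoundedContinuousFunction.norm_le (norm_nonneg h)).2 h.norm_primitive_le

theorem primitive_apply (h : UnitL2 X) (x : Icc (0 : ℝ) 1) :
    primitive h x = ∫ s in (0 : ℝ)..x, h s :=
  rfl

open BoundedContinuousFunction in
/-- The inclusion of the continuous functions on `[0,1]` into `L²(0,1; X)`. -/
def ofContinuous : (Icc (0 : ℝ) 1 →ᵇ X) →L[ℂ] UnitL2 X :=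
  BoundedContinuousFunction.toLp 2 (volume.restrict (Icc (0 : ℝ) 1)) ℂ ∘L
    compContinuousCLM X ℂ ContinuousMap.projIccCM

/-- The Volterra operator, which maps `h` to its primitive `x ↦ ∫₀ˣ h`. -/
def volterra : UnitL2 X →L[ℂ] UnitL2 X :=
  ofContinuous ∘L primitive

/-- The integral `∫₀¹ h` of `h ∈ L²(0,1; X)`. -/
def integral : UnitL2 X →L[ℂ] X :=
  BoundedContinuousFunction.evalCLM ℂ 1 ∘L primitive

/-- The constant functions in `L²(0,1; X)`. -/
def const : X →L[ℂ] UnitL2 X :=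
  Lp.constL 2 (volume.restrict (Icc (0 : ℝ) 1)) ℂ

theorem coeFn_volterra (h : UnitL2 X) :
    volterra h =ᵐ[volume.restrict (Icc (0 : ℝ) 1)] fun x => ∫ s in (0 : ℝ)..x, h s := by
  filter_upwards [BoundedContinuousFunction.coeFn_toLp 2 (volume.restrict (Icc (0 : ℝ) 1)) ℂ
    ((primitive h).compContinuous ContinuousMap.projIccCM),
    ae_restrict_mem measurableSet_Icc] with x toLp_eq hx
  refine toLp_eq.trans ?_
  simp [primitive_apply, ContinuousMap.projIccCM, projIcc_of_mem _ hx]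

theorem integral_apply (h : UnitL2 X) : integral h = ∫ s in (0 : ℝ)..1, h s :=
  rfl

theorem coeFn_const (c : X) : const c =ᵐ[volume.restrict (Icc (0 : ℝ) 1)] fun _ => c :=
  Lp.coeFn_const 2 _ c

theorem intervalIntegral_eq_of_volterra_eq_const {h : UnitL2 X} {c : X}
    (hc : volterra h = const c) (x : Icc (0 : ℝ) 1) : ∫ s in (0 : ℝ)..x, h s = c := by
  have ae_eq : (fun x => ∫ s in (0 : ℝ)..x, h s)
      =ᵐ[volume.restrict (Icc (0 : ℝ) 1)] fun _ => c := by
    filter_upwards [coeFn_volterra h, coeFn_const c] with x h_volterra h_const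
    rw [← h_volterra, hc, h_const]
  exact Measure.eqOn_Icc_of_ae_eq volume zero_ne_one ae_eq
    (continuousOn_iff_continuous_domRestrict.2 h.continuous_primitive) continuousOn_const x.2

theorem isCompactOperator_volterra [ProperSpace X] :
    IsCompactOperator (volterra : UnitL2 X →L[ℂ] UnitL2 X) := by
  have arzela_ascoli : IsCompact (closure (primitive '' Metric.closedBall (0 : UnitL2 X) 1)) := by
    refine BoundedContinuousFunction.arzela_ascoli (Metric.closedBall 0 1)
      (isCompact_closedBall _ _) _ ?_ ?_
    · rintro _ x ⟨h, hh, rfl⟩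
      rw [mem_closedBall_zero_iff] at hh ⊢
      exact (h.norm_primitive_le x).trans hh
    · refine Metric.equicontinuous_of_continuity_modulus (fun d => √d) ?_ _ ?_
      · simpa using Real.continuous_sqrt.tendsto 0
      · rintro x y ⟨_, h, hh, rfl⟩
        rw [mem_closedBall_zero_iff] at hh
        exact (h.dist_primitive_le x y).trans (mul_le_of_le_one_left (Real.sqrt_nonneg _) hh)
  have : IsCompactOperator (primitive (X := X)) :=
    ⟨_, arzela_ascoli, Filter.mem_of_superset (Metric.closedBall_mem_nhds 0 one_pos)
      fun h hh => subset_closure (mem_image_of_mem _ hh)⟩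
  exact this.clm_comp ofContinuous

variable [CompleteSpace X]

theorem integral_const (c : X) : integral (const c) = c := by
  rw [integral_apply, intervalIntegral_congr_of_ae_Icc (coeFn_const c) (by simp)]
  simp

end Primitive

section Duality

variable {X : Type*} [NormedAddCommGroup X] [InnerProductSpace ℂ X] [CompleteSpace X]

theorem inner_const_left (c : X) (f : UnitL2 X) : ⟪const c, f⟫_ℂ = ⟪c, integral f⟫_ℂ := by
  rw [L2.inner_def, integral_apply, intervalIntegral.integral_of_le zero_le_one,
    ← integral_Icc_eq_integral_Ioc, ← integral_inner f.integrableOn]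
  refine integral_congr_ae ?_
  filter_upwards [coeFn_const c] with x hx
  rw [hx]

theorem inner_const_right (f : UnitL2 X) (c : X) : ⟪f, const c⟫_ℂ = ⟪integral f, c⟫_ℂ := by
  rw [← inner_conj_symm, inner_const_left, inner_conj_symm]

theorem inner_volterra_left_add_right (g h : UnitL2 X) :
    ⟪volterra g, h⟫_ℂ + ⟪g, volterra h⟫_ℂ = ⟪integral g, integral h⟫_ℂ := by
  have dense := BoundedContinuousFunction.toLp_denseRange X
    (volume.restrict (Icc (0 : ℝ) 1)) ℂ (ENNReal.ofNat_ne_top (n := 2))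
  refine dense.induction_on₂ (isClosed_eq (by fun_prop) (by fun_prop)) (fun G H => ?_) g h
  have coeFn (F : BoundedContinuousFunction ℝ X) :=
    BoundedContinuousFunction.coeFn_toLp 2 (volume.restrict (Icc (0 : ℝ) 1)) ℂ F
  have coeFn_volterra_toLp (F : BoundedContinuousFunction ℝ X) :
      volterra (F.toLp 2 (volume.restrict (Icc (0 : ℝ) 1)) ℂ)
        =ᵐ[volume.restrict (Icc (0 : ℝ) 1)] fun x => ∫ s in (0 : ℝ)..x, F s := by
    filter_upwards [coeFn_volterra (F.toLp 2 (volume.restrict (Icc (0 : ℝ) 1)) ℂ),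
      ae_restrict_mem measurableSet_Icc] with x hx hx01
    rw [hx, intervalIntegral_congr_of_ae_Icc (coeFn F) hx01]
  have product_rule (x : ℝ) :=
    ((G.continuous.integral_hasStrictDerivAt 0 x).hasDerivAt).inner ℂ
      (H.continuous.integral_hasStrictDerivAt 0 x).hasDerivAt
  have continuous_deriv : Continuous fun x => ⟪∫ s in (0 : ℝ)..x, G s, H x⟫_ℂ +
      ⟪G x, ∫ s in (0 : ℝ)..x, H s⟫_ℂ := by
    have continuous_primitive (F : BoundedContinuousFunction ℝ X) :
        Continuous fun x : ℝ => ∫ s in (0 : ℝ)..x, F s :=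
      intervalIntegral.continuous_primitive F.continuous.intervalIntegrable 0
    exact ((continuous_primitive G).inner H.continuous).add
      (G.continuous.inner (continuous_primitive H))
  rw [integral_apply, integral_apply, intervalIntegral_congr_of_ae_Icc (coeFn G) (by simp),
    intervalIntegral_congr_of_ae_Icc (coeFn H) (by simp), L2.inner_def, L2.inner_def,
    ← integral_add (L2.integrable_inner _ _) (L2.integrable_inner _ _)]
  have ftc := intervalIntegral.integral_eq_sub_of_hasDerivAt (a := 0) (b := 1)
    (fun x _ => product_rule x) (continuous_deriv.intervalIntegrable 0 1)
  rw [intervalIntegral.integral_same, inner_zero_left, sub_zero,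
    intervalIntegral.integral_of_le zero_le_one, ← integral_Icc_eq_integral_Ioc] at ftc
  rw [← ftc]
  refine integral_congr_ae ?_
  filter_upwards [coeFn G, coeFn H, coeFn_volterra_toLp G, coeFn_volterra_toLp H]
    with x hG hH hTG hTH
  rw [hG, hH, hTG, hTH]

end Duality

section WeakDerivative

variable {X Y : Type*} [NormedAddCommGroup X] [NormedSpace ℂ X]
  [NormedAddCommGroup Y] [NormedSpace ℂ Y]

/-- `f ∈ H¹(0,1; X)` with derivative `f'` and boundary values `f(0) = a` and `f(1) = b`, expressed
by the fundamental theorem of calculus. -/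
structure HasWeakDeriv (f f' : UnitL2 X) (a b : X) : Prop where
  eq_const_add_volterra : f = const a + volterra f'
  right_eq : b = a + integral f'

theorem hasWeakDeriv_const_add_volterra (a : X) (h : UnitL2 X) :
    HasWeakDeriv (const a + volterra h) h a (a + integral h) :=
  ⟨rfl, rfl⟩

theorem hasWeakDeriv_const (a : X) : HasWeakDeriv (const a) 0 a a :=
  ⟨by simp, by simp⟩

theorem coeFn_const_add_volterra (a : X) (h : UnitL2 X) :
    (const a + volterra h : UnitL2 X) =ᵐ[volume.restrict (Icc (0 : ℝ) 1)]
      fun x => a + ∫ s in (0 : ℝ)..x, h s := by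
  filter_upwards [Lp.coeFn_add (const a) (volterra h), coeFn_const a, coeFn_volterra h]
    with x h_add h_const h_volterra
  rw [h_add, Pi.add_apply, h_const, h_volterra]

namespace HasWeakDeriv

variable {f f' g g' : UnitL2 X} {a b c d : X}

theorem of_primitive {F : ℝ → X} (hf : f =ᵐ[volume.restrict (Icc (0 : ℝ) 1)] F)
    (hF : ∀ x ∈ Icc (0 : ℝ) 1, F x = F 0 + ∫ s in (0 : ℝ)..x, f' s) :
    HasWeakDeriv f f' (F 0) (F 1) where
  eq_const_add_volterra := by
    refine Lp.ext ?_
    filter_upwards [hf, coeFn_const_add_volterra (F 0) f', ae_restrict_mem measurableSet_Icc]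
      with x hfx hx hx01
    rw [hfx, hx, hF x hx01]
  right_eq := hF 1 (by simp)

theorem ae_eq (hf : HasWeakDeriv f f' a b) :
    f =ᵐ[volume.restrict (Icc (0 : ℝ) 1)] fun x => a + ∫ s in (0 : ℝ)..x, f' s := by
  rw [hf.eq_const_add_volterra]
  exact coeFn_const_add_volterra a f'

theorem sub (hf : HasWeakDeriv f f' a b) (hg : HasWeakDeriv g g' c d) :
    HasWeakDeriv (f - g) (f' - g') (a - c) (b - d) where
  eq_const_add_volterra := by
    rw [hf.eq_const_add_volterra, hg.eq_const_add_volterra, map_sub, map_sub]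
    abel
  right_eq := by
    rw [hf.right_eq, hg.right_eq, map_sub]
    abel

theorem smul (r : ℂ) (hf : HasWeakDeriv f f' a b) :
    HasWeakDeriv (r • f) (r • f') (r • a) (r • b) where
  eq_const_add_volterra := by
    rw [hf.eq_const_add_volterra, smul_add, map_smul, map_smul]
  right_eq := by
    rw [hf.right_eq, smul_add, map_smul]

theorem compLpL [CompleteSpace X] [CompleteSpace Y] (L : X →L[ℂ] Y) (hf : HasWeakDeriv f f' a b) :
    HasWeakDeriv (L.compLpL 2 _ f) (L.compLpL 2 _ f') (L a) (L b) := by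
  have integral_comp {x : ℝ} (hx : x ∈ Icc (0 : ℝ) 1) :
      ∫ s in (0 : ℝ)..x, L.compLpL 2 (volume.restrict (Icc (0 : ℝ) 1)) f' s =
        L (∫ s in (0 : ℝ)..x, f' s) := by
    rw [intervalIntegral_congr_of_ae_Icc (L.coeFn_compLpL f') hx]
    exact L.intervalIntegral_comp_comm (f'.intervalIntegrable (by simp) hx)
  have := of_primitive (f := L.compLpL 2 _ f) (f' := L.compLpL 2 _ f')
    (F := fun x => L (a + ∫ s in (0 : ℝ)..x, f' s)) ?_ ?_
  · simpa [hf.right_eq, integral_apply] using this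
  · filter_upwards [L.coeFn_compLpL f, hf.ae_eq] with x hLf hfx
    rw [hLf, hfx]
  · intro x hx
    rw [integral_comp hx]
    simp

end HasWeakDeriv

theorem measurePreserving_one_sub :
    MeasurePreserving (fun x : ℝ => 1 - x) (volume.restrict (Icc (0 : ℝ) 1))
      (volume.restrict (Icc (0 : ℝ) 1)) := by
  have := (volume.measurePreserving_sub_left (1 : ℝ)).restrict_preimage
    (measurableSet_Icc (a := (0 : ℝ)) (b := 1))
  simpa using this

/-- Reversal of the parametrization, `f ↦ f (1 - ·)`. -/
def reflect : UnitL2 X →ₗᵢ[ℂ] UnitL2 X :=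
  Lp.compMeasurePreservingₗᵢ ℂ (fun x => 1 - x) measurePreserving_one_sub

theorem coeFn_reflect (f : UnitL2 X) :
    reflect f =ᵐ[volume.restrict (Icc (0 : ℝ) 1)] fun x => f (1 - x) :=
  Lp.coeFn_compMeasurePreserving f measurePreserving_one_sub

theorem reflect_const (c : X) : reflect (const c) = const c := by
  refine Lp.ext ?_
  filter_upwards [coeFn_reflect (const c), coeFn_const c,
    measurePreserving_one_sub.quasiMeasurePreserving.ae (coeFn_const c)] with x h1 h2 h3
  rw [h1, h2, h3]

theorem HasWeakDeriv.reflect {f f' : UnitL2 X} {a b : X} (hf : HasWeakDeriv f f' a b) :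
    HasWeakDeriv (reflect f) (-reflect f') b a := by
  have := of_primitive (f := CKHeat.reflect f) (f' := -CKHeat.reflect f')
    (F := fun x => a + ∫ s in (0 : ℝ)..(1 - x), f' s) ?_ ?_
  · simpa [hf.right_eq, integral_apply] using this
  · filter_upwards [coeFn_reflect f, measurePreserving_one_sub.quasiMeasurePreserving.ae hf.ae_eq]
      with x h_reflect hfx
    rw [h_reflect, hfx]
  · intro x hx
    have hx' : 1 - x ∈ Icc (0 : ℝ) 1 := ⟨sub_nonneg.2 hx.2, sub_le_self 1 hx.1⟩
    have : ∫ s in (0 : ℝ)..x, (-CKHeat.reflect f' : UnitL2 X) s =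
        -∫ s in (1 - x)..1, f' s := by
      have h_neg : (-CKHeat.reflect f' : UnitL2 X)
          =ᵐ[volume.restrict (Icc (0 : ℝ) 1)] fun s => -f' (1 - s) := by
        filter_upwards [Lp.coeFn_neg (CKHeat.reflect f'), coeFn_reflect f'] with s h_neg h_reflect
        rw [h_neg, Pi.neg_apply, h_reflect]
      rw [intervalIntegral_congr_of_ae_Icc h_neg hx, intervalIntegral.integral_neg,
        intervalIntegral.integral_comp_sub_left (fun s => f' s) 1, sub_zero]
    rw [this, sub_zero, add_assoc, ← sub_eq_add_neg,
      ← intervalIntegral.integral_add_adjacent_intervals (c := 1)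
        (f'.intervalIntegrable (by simp) hx') (f'.intervalIntegrable hx' (by simp)),
      add_sub_cancel_right]

theorem HasWeakDeriv.exists_of_endpoints {f f' : UnitL2 X} {a b a' b' : X}
    (hf : HasWeakDeriv f f' a b) (endpoints : (a = a' ∧ b = b') ∨ (a = b' ∧ b = a')) :
    ∃ g g' : UnitL2 X, HasWeakDeriv g g' a' b' ∧ ‖g'‖ = ‖f'‖ ∧
      ∀ c, ‖g - const c‖ = ‖f - const c‖ := by
  obtain ⟨rfl, rfl⟩ | ⟨rfl, rfl⟩ := endpoints
  · exact ⟨f, f', hf, rfl, fun _ => rfl⟩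
  · refine ⟨CKHeat.reflect f, -CKHeat.reflect f', hf.reflect, ?_, fun c => ?_⟩
    · rw [norm_neg, LinearIsometry.norm_map]
    · rw [← reflect_const c, ← map_sub, LinearIsometry.norm_map, reflect_const]

end WeakDerivative

section IntegrationByParts

variable {X : Type*} [NormedAddCommGroup X] [InnerProductSpace ℂ X] [CompleteSpace X]

theorem HasWeakDeriv.inner_add_inner {f f' g g' : UnitL2 X} {a b c d : X}
    (hf : HasWeakDeriv f f' a b) (hg : HasWeakDeriv g g' c d) :
    ⟪f', g⟫_ℂ + ⟪f, g'⟫_ℂ = ⟪b, d⟫_ℂ - ⟪a, c⟫_ℂ := by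
  have volterra_duality := inner_volterra_left_add_right f' g'
  rw [hf.eq_const_add_volterra, hg.eq_const_add_volterra, hf.right_eq, hg.right_eq]
  simp only [inner_add_left, inner_add_right, inner_const_left, inner_const_right]
  linear_combination volterra_duality

theorem eq_const_of_forall_inner_eq_zero {r : UnitL2 X}
    (hr : ∀ k : UnitL2 X, integral k = 0 → ⟪k, r⟫_ℂ = 0) : r = const (integral r) := by
  have integral_sub_mean : integral (r - const (integral r)) = 0 := by
    rw [map_sub, integral_const, sub_self]
  rw [← sub_eq_zero, ← inner_self_eq_zero (𝕜 := ℂ), inner_sub_right, hr _ integral_sub_mean,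
    inner_const_right, integral_sub_mean, inner_zero_left, sub_zero]

theorem exists_integral_eq_zero_forall_volterra_ne_const [Nontrivial X] :
    ∃ k : UnitL2 X, integral k = 0 ∧ ∀ c, volterra k ≠ const c := by
  by_contra! volterra_const
  obtain ⟨u, hu⟩ := exists_ne (0 : X)
  have volterra_eq_zero {k : UnitL2 X} (hk : integral k = 0) : volterra k = 0 := by
    obtain ⟨c, hc⟩ := volterra_const k hk
    have hc₀ := intervalIntegral_eq_of_volterra_eq_const hc 0
    rw [hc, ← hc₀]
    simp
  have volterra_const_eq_const := eq_const_of_forall_inner_eq_zero (r := volterra (const u))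
    fun k hk => by simpa [volterra_eq_zero hk, hk] using inner_volterra_left_add_right k (const u)
  have at_zero := intervalIntegral_eq_of_volterra_eq_const volterra_const_eq_const 0
  have at_one := intervalIntegral_eq_of_volterra_eq_const volterra_const_eq_const 1
  refine hu ?_
  calc u = integral (const u) := (integral_const u).symm
    _ = integral (volterra (const u)) := at_one
    _ = 0 := by simpa using at_zero.symm

theorem exists_hasWeakDeriv_of_forall_inner {f f' : UnitL2 X}
    (h : ∀ k k' : UnitL2 X, HasWeakDeriv k k' 0 0 → ⟪k, f'⟫_ℂ = -⟪k', f⟫_ℂ) :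
    ∃ a b, HasWeakDeriv f f' a b := by
  have sub_volterra_eq_const := eq_const_of_forall_inner_eq_zero (r := f - volterra f')
    fun k' hk' => by
      have weak := h (volterra k') k' ⟨by simp, by simp [hk']⟩
      have by_parts := inner_volterra_left_add_right k' f'
      rw [hk', inner_zero_left] at by_parts
      rw [inner_sub_right]
      linear_combination weak - by_parts
  exact ⟨_, _, sub_eq_iff_eq_add.1 sub_volterra_eq_const, rfl⟩

end IntegrationByParts

end UnitInterval

section SingularVector

open scoped InnerProduct

theorem exists_comp_adjoint_eigenvector {H K : Type*} [NormedAddCommGroup H]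
    [InnerProductSpace ℂ H] [CompleteSpace H] [NormedAddCommGroup K] [InnerProductSpace ℂ K]
    [CompleteSpace K] {A : H →L[ℂ] K} (hA : IsCompactOperator A) (hA₀ : A ≠ 0) :
    ∃ f ≠ 0, A ((A†) f) = ((‖A‖ ^ 2 : ℝ) : ℂ) • f := by
  obtain ⟨x, hx⟩ := DFunLike.ne_iff.1 hA₀
  have : Nontrivial K := ⟨_, _, hx⟩
  have norm_comp_adjoint : ‖A ∘L A†‖ = ‖A‖ ^ 2 := by
    simpa [sq] using (A†).norm_adjoint_comp_self
  have norm_mem_spectrum : ((‖A‖ ^ 2 : ℝ) : ℂ) ∈ spectrum ℂ (A ∘L A†) := by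
    rw [← norm_comp_adjoint]
    exact spectrum.algebraMap_mem ℂ <| CStarAlgebra.norm_mem_spectrum_of_nonneg <|
      (ContinuousLinearMap.nonneg_iff_isPositive _).2 A.isPositive_self_comp_adjoint
  have norm_ne_zero : ((‖A‖ ^ 2 : ℝ) : ℂ) ≠ 0 := by simpa using hA₀
  obtain ⟨f, hf⟩ := (((hA.comp_clm (A†)).hasEigenvalue_iff_mem_spectrum
    norm_ne_zero).2 norm_mem_spectrum).exists_hasEigenvector
  exact ⟨f, hf.2, hf.apply_eq_smul⟩

end SingularVector

section Decay

theorem le_exp_mul_of_hasDerivAt_le {v v' : ℝ → ℝ} {c t : ℝ} (cont : ContinuousOn v (Ici 0))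
    (deriv : ∀ s, 0 < s → HasDerivAt v (v' s) s) (le : ∀ s, 0 < s → v' s ≤ c * v s)
    (ht : 0 ≤ t) : v t ≤ Real.exp (c * t) * v 0 := by
  have deriv_exp (s : ℝ) : HasDerivAt (fun s => Real.exp (-(c * s)))
      (Real.exp (-(c * s)) * -c) s := by
    simpa using ((hasDerivAt_id s).const_mul c).neg.exp
  have antitone : AntitoneOn (fun s => Real.exp (-(c * s)) * v s) (Ici 0) := by
    refine antitoneOn_of_hasDerivWithinAt_nonpos (convex_Ici 0) (.mul (by fun_prop) cont)
      (fun s hs => ((deriv_exp s).mul (deriv s (interior_Ici.subset hs))).hasDerivWithinAt)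
      fun s hs => ?_
    linarith [mul_le_mul_of_nonneg_left (le s (interior_Ici.subset hs))
      (Real.exp_pos (-(c * s))).le]
  have : (Real.exp (c * t))⁻¹ * v t ≤ v 0 := by
    simpa [← Real.exp_neg] using antitone self_mem_Ici ht ht
  exact (inv_mul_le_iff₀ (Real.exp_pos _)).1 this

variable {H : Type*} [NormedAddCommGroup H] [InnerProductSpace ℂ H] [NormedSpace ℝ H]

theorem hasDerivAt_norm_sq {w : ℝ → H} {w' : H} {t : ℝ} (hw : HasDerivAt w w' t) :
    HasDerivAt (fun s => ‖w s‖ ^ 2) (2 * (⟪w t, w'⟫_ℂ).re) t := by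
  have norm_sq_eq : (fun s => ‖w s‖ ^ 2) = Complex.reCLM ∘ fun s => ⟪w s, w s⟫_ℂ := by
    ext s
    exact (inner_self_eq_norm_sq (𝕜 := ℂ) (w s)).symm
  rw [norm_sq_eq]
  refine (Complex.reCLM.hasFDerivAt.comp_hasDerivAt t (hw.inner ℂ hw)).congr_deriv ?_
  rw [map_add, Complex.reCLM_apply, Complex.reCLM_apply, two_mul]
  exact congrArg _ (inner_re_symm (𝕜 := ℂ) w' (w t))

theorem norm_le_exp_mul_of_re_inner_le {w w' : ℝ → H} {lam t : ℝ}
    (cont : ContinuousOn w (Ici 0)) (deriv : ∀ s, 0 < s → HasDerivAt w (w' s) s)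
    (le : ∀ s, 0 < s → (⟪w s, w' s⟫_ℂ).re ≤ -lam * ‖w s‖ ^ 2) (ht : 0 ≤ t) :
    ‖w t‖ ≤ Real.exp (-lam * t) * ‖w 0‖ := by
  refine le_of_sq_le_sq ?_ (by positivity)
  calc ‖w t‖ ^ 2 ≤ Real.exp (2 * -lam * t) * ‖w 0‖ ^ 2 :=
        le_exp_mul_of_hasDerivAt_le (v := fun s => ‖w s‖ ^ 2) (cont.norm.pow 2)
          (fun s hs => hasDerivAt_norm_sq (deriv s hs)) (fun s hs => by linarith [le s hs]) ht
    _ = (Real.exp (-lam * t) * ‖w 0‖) ^ 2 := by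
        rw [mul_pow, ← Real.exp_nat_mul, Nat.cast_ofNat, mul_assoc 2]

end Decay

section Edges

variable {E : Type*} [Fintype E]

/-- The restriction of a function on the metric graph to the edge `e`. -/
def edge (e : E) : L2 E →L[ℂ] UnitL2 ℂ :=
  (EuclideanSpace.proj e).compLpL 2 _

theorem coeFn_edge (e : E) (f : L2 E) :
    edge e f =ᵐ[volume.restrict (Icc (0 : ℝ) 1)] fun x => f x e :=
  (EuclideanSpace.proj (𝕜 := ℂ) e).coeFn_compLpL f

theorem edge_const (e : E) (c : EuclideanSpace ℂ E) : edge e (const c) = const (c e) := by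
  refine Lp.ext ?_
  filter_upwards [coeFn_edge e (const c), coeFn_const c, coeFn_const (c e)] with x h1 h2 h3
  rw [h1, h2, h3]

theorem inner_eq_sum_inner_edge (f g : L2 E) : ⟪f, g⟫_ℂ = ∑ e, ⟪edge e f, edge e g⟫_ℂ := by
  simp only [L2.inner_def]
  rw [← integral_finsetSum _ fun e _ => L2.integrable_inner (edge e f) (edge e g)]
  refine integral_congr_ae ?_
  filter_upwards [ae_all_iff.2 fun e => coeFn_edge e f, ae_all_iff.2 fun e => coeFn_edge e g]
    with x hf hg
  simp only [PiLp.inner_apply, hf, hg]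

theorem norm_sq_eq_sum_norm_sq_edge (f : L2 E) : ‖f‖ ^ 2 = ∑ e, ‖edge e f‖ ^ 2 := by
  rw [← @inner_self_eq_norm_sq ℂ, inner_eq_sum_inner_edge, map_sum]
  simp only [inner_self_eq_norm_sq]

theorem ext_edge {f g : L2 E} (h : ∀ e, edge e f = edge e g) : f = g := by
  rw [← sub_eq_zero, ← norm_eq_zero, ← sq_eq_zero_iff, norm_sq_eq_sum_norm_sq_edge]
  simp [h]

theorem exists_forall_edge_eq (g : E → UnitL2 ℂ) : ∃ f : L2 E, ∀ e, edge e f = g e := by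
  have memLp : MemLp (fun x => WithLp.toLp 2 fun e => g e x) 2
      (volume.restrict (Icc (0 : ℝ) 1)) :=
    MemLp.of_eval_piLp fun e => Lp.memLp (g e)
  refine ⟨memLp.toLp, fun e => Lp.ext ?_⟩
  filter_upwards [coeFn_edge e memLp.toLp, memLp.coeFn_toLp] with x h_edge h_toLp
  rw [h_edge, h_toLp]

theorem hasWeakDeriv_iff_forall_edge {f f' : L2 E} {a b : EuclideanSpace ℂ E} :
    HasWeakDeriv f f' a b ↔ ∀ e, HasWeakDeriv (edge e f) (edge e f') (a e) (b e) := by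
  refine ⟨fun h e => h.compLpL (EuclideanSpace.proj e), fun h => ⟨ext_edge fun e => ?_, ?_⟩⟩
  · have := (hasWeakDeriv_const_add_volterra a f').compLpL (EuclideanSpace.proj (𝕜 := ℂ) e)
    exact (h e).eq_const_add_volterra.trans this.eq_const_add_volterra.symm
  · ext e
    have := (hasWeakDeriv_const_add_volterra a f').compLpL (EuclideanSpace.proj (𝕜 := ℂ) e)
    exact (h e).right_eq.trans this.right_eq.symm

end Edges

section Equilibrium

variable {E : Type*} [Fintype E]

/-- The constant function `1` on the metric graph. -/
def one : L2 E :=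
  const (WithLp.toLp 2 fun _ => 1)

theorem edge_smul_one (c : ℂ) (e : E) : edge e (c • one) = const c := by
  rw [one, ← map_smul, edge_const]
  simp

theorem inner_one_left (f : L2 E) : ⟪one, f⟫_ℂ = ∑ e, integral f e := by
  rw [one, inner_const_left, PiLp.inner_apply]
  simp

theorem norm_sq_one : ‖(one : L2 E)‖ ^ 2 = Fintype.card E := by
  rw [← @inner_self_eq_norm_sq ℂ, inner_one_left, one, integral_const]
  simp

theorem equilibrium_eq_starProjection (f : L2 E) :
    equilibrium f = (ℂ ∙ one).starProjection f := by
  have integral_edge (e : E) :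
      ∫ x in (0 : ℝ)..1, (f : ℝ → EuclideanSpace ℂ E) x e = integral f e :=
    (EuclideanSpace.proj (𝕜 := ℂ) e).intervalIntegral_comp_comm
      (UnitL2.intervalIntegrable f (by simp) (by simp))
  rw [Submodule.starProjection_singleton, inner_one_left, norm_sq_one,
    one, ← map_smul, equilibrium]
  simp_rw [integral_edge]
  refine congrArg (const (X := EuclideanSpace ℂ E)) ?_
  ext e
  simp [div_eq_inv_mul]

theorem sub_equilibrium_eq_starProjection (f : L2 E) :
    f - equilibrium f = (ℂ ∙ one)ᗮ.starProjection f := by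
  rw [equilibrium_eq_starProjection, Submodule.starProjection_orthogonal_val]

theorem equilibrium_smul_one (c : ℂ) : equilibrium (c • one : L2 E) = c • one := by
  rw [equilibrium_eq_starProjection, Submodule.starProjection_eq_self_iff]
  exact Submodule.smul_mem _ c (Submodule.mem_span_singleton_self one)

theorem equilibrium_eq_zero_iff {f : L2 E} : equilibrium f = 0 ↔ ⟪one, f⟫_ℂ = 0 := by
  rw [equilibrium_eq_starProjection, Submodule.starProjection_apply_eq_zero_iff,
    Submodule.mem_orthogonal_singleton_iff_inner_right]

end Equilibrium

section Graph

variable {V E : Type*}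

theorem Multigraph.Connected.exists_forall_eq {X : Type*} {Γ : Multigraph V E}
    (hΓ : Γ.Connected) {φ : V → X} (hφ : ∀ e, φ (Γ.src e) = φ (Γ.tgt e)) : ∃ c, ∀ v, φ v = c := by
  obtain ⟨v₀⟩ := hΓ.nonempty
  refine ⟨φ v₀, fun v => ?_⟩
  obtain ⟨walk⟩ := hΓ.preconnected v v₀
  induction walk with
  | nil => rfl
  | cons adj _ ih =>
    obtain ⟨-, ⟨e, rfl, rfl⟩ | ⟨e, rfl, rfl⟩⟩ := (SimpleGraph.fromRel_adj _ _ _).1 adj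
    · exact (hφ e).trans ih
    · exact (hφ e).symm.trans ih

/-- The vertex function `φ`, evaluated at the endpoint `s e` of each edge `e`. -/
def pullback (s : E → V) : (V → ℂ) →ₗ[ℂ] EuclideanSpace ℂ E :=
  (WithLp.linearEquiv 2 ℂ (E → ℂ)).symm.toLinearMap ∘ₗ LinearMap.funLeft ℂ ℂ s

@[simp]
theorem pullback_apply (s : E → V) (φ : V → ℂ) (e : E) : pullback s φ e = φ (s e) :=
  rfl

variable [Fintype E]

open Classical in
theorem Multigraph.kirchhoff_iff (Γ : Multigraph V E) (b₀ b₁ : EuclideanSpace ℂ E) :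
    (∀ v, ∑ e, ((if Γ.tgt e = v then b₁ e else 0) - (if Γ.src e = v then b₀ e else 0)) = 0) ↔
      ∀ ψ : V → ℂ, ⟪pullback Γ.tgt ψ, b₁⟫_ℂ = ⟪pullback Γ.src ψ, b₀⟫_ℂ := by
  refine ⟨fun kirchhoff ψ => ?_, fun weak v => ?_⟩
  · let S : Finset V := Finset.univ.image Γ.src ∪ Finset.univ.image Γ.tgt
    rw [← sub_eq_zero]
    calc ⟪pullback Γ.tgt ψ, b₁⟫_ℂ - ⟪pullback Γ.src ψ, b₀⟫_ℂ
        = ∑ e, ∑ v ∈ S, (starRingEnd ℂ (ψ v)) *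
            ((if Γ.tgt e = v then b₁ e else 0) - (if Γ.src e = v then b₀ e else 0)) := by
          simp only [mul_sub, mul_ite, mul_zero, Finset.sum_sub_distrib, Finset.sum_ite_eq]
          simp [PiLp.inner_apply, S, mul_comm]
      _ = ∑ v ∈ S, (starRingEnd ℂ (ψ v)) *
            ∑ e, ((if Γ.tgt e = v then b₁ e else 0) - (if Γ.src e = v then b₀ e else 0)) := by
          rw [Finset.sum_comm]
          simp_rw [Finset.mul_sum]
      _ = 0 := by simp_rw [kirchhoff, mul_zero, Finset.sum_const_zero]
  · have := weak (Pi.single v 1)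
    simpa [PiLp.inner_apply, Pi.single_apply, sub_eq_zero] using this

namespace Multigraph

variable {Γ : Multigraph V E} {f g h k : L2 E}

/-- `f` lies in `H¹` of the metric graph, i.e. it is in `H¹` on every edge and continuous in the
vertices, and `h` is its edgewise derivative. -/
def IsWeakDeriv (Γ : Multigraph V E) (f h : L2 E) : Prop :=
  ∃ φ : V → ℂ, HasWeakDeriv f h (pullback Γ.src φ) (pullback Γ.tgt φ)

theorem IsWeakDeriv.sub (hf : Γ.IsWeakDeriv f h) (hg : Γ.IsWeakDeriv g k) :
    Γ.IsWeakDeriv (f - g) (h - k) := by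
  obtain ⟨φ, hφ⟩ := hf
  obtain ⟨ψ, hψ⟩ := hg
  exact ⟨φ - ψ, by simpa only [map_sub] using hφ.sub hψ⟩

theorem IsWeakDeriv.smul (c : ℂ) (hf : Γ.IsWeakDeriv f h) :
    Γ.IsWeakDeriv (c • f) (c • h) := by
  obtain ⟨φ, hφ⟩ := hf
  exact ⟨c • φ, by simpa only [map_smul] using hφ.smul c⟩

theorem isWeakDeriv_one (Γ : Multigraph V E) : Γ.IsWeakDeriv one 0 :=
  ⟨fun _ => 1, hasWeakDeriv_const _⟩

theorem isCKLaplacian_iff_exists_hasWeakDeriv :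
    Γ.IsCKLaplacian f g ↔ ∃ h, Γ.IsWeakDeriv f h ∧ ∃ b₀ b₁, HasWeakDeriv h g b₀ b₁ ∧
      ∀ ψ : V → ℂ, ⟪pullback Γ.tgt ψ, b₁⟫_ℂ = ⟪pullback Γ.src ψ, b₀⟫_ℂ := by
  constructor
  · rintro ⟨F, F', hf, hF, hF', ⟨φ, hφ⟩, kirchhoff⟩
    have h_ae : (const (F' 0) + volterra g : L2 E) =ᵐ[volume.restrict (Icc (0 : ℝ) 1)] F' := by
      filter_upwards [coeFn_const_add_volterra (F' 0) g, ae_restrict_mem measurableSet_Icc]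
        with x hx hx01
      rw [hx, hF' x hx01]
    have hφ₀ : F 0 = pullback Γ.src φ := by ext e; exact (hφ e).1
    have hφ₁ : F 1 = pullback Γ.tgt φ := by ext e; exact (hφ e).2
    refine ⟨const (F' 0) + volterra g, ⟨φ, ?_⟩, F' 0, F' 1, .of_primitive h_ae hF',
      (Γ.kirchhoff_iff _ _).1 kirchhoff⟩
    rw [← hφ₀, ← hφ₁]
    refine .of_primitive hf fun x hx => ?_
    rw [hF x hx, intervalIntegral_congr_of_ae_Icc h_ae hx]
  · rintro ⟨h, ⟨φ, hφ⟩, b₀, b₁, hb, kirchhoff⟩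
    refine ⟨fun x => pullback Γ.src φ + ∫ s in (0 : ℝ)..x, h s,
      fun x => b₀ + ∫ s in (0 : ℝ)..x, g s, hφ.ae_eq, fun x hx => ?_, by simp,
      ⟨φ, fun e => ⟨by simp, ?_⟩⟩, (Γ.kirchhoff_iff _ _).2 ?_⟩
    · simp [intervalIntegral_congr_of_ae_Icc hb.ae_eq hx]
    · exact congrArg (· e) hφ.right_eq.symm
    · simpa [← integral_apply, ← hb.right_eq] using kirchhoff

/-- The Kirchhoff condition is the natural boundary condition of the form `f ↦ ‖f'‖²`. -/
theorem isCKLaplacian_iff :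
    Γ.IsCKLaplacian f g ↔
      ∃ h, Γ.IsWeakDeriv f h ∧ ∀ k k', Γ.IsWeakDeriv k k' → ⟪k, g⟫_ℂ = -⟪k', h⟫_ℂ := by
  rw [isCKLaplacian_iff_exists_hasWeakDeriv]
  refine exists_congr fun h => and_congr_right fun _ => ⟨?_, fun weak => ?_⟩
  · rintro ⟨b₀, b₁, hb, kirchhoff⟩ k k' ⟨ψ, hk⟩
    linear_combination hk.inner_add_inner hb + kirchhoff ψ
  · obtain ⟨b₀, b₁, hb⟩ := exists_hasWeakDeriv_of_forall_inner fun k k' hk =>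
      weak k k' ⟨0, by simpa only [map_zero] using hk⟩
    refine ⟨b₀, b₁, hb, fun ψ => ?_⟩
    have interpolant : HasWeakDeriv
        (const (pullback Γ.src ψ) + volterra (const (pullback Γ.tgt ψ - pullback Γ.src ψ)))
        (const (pullback Γ.tgt ψ - pullback Γ.src ψ)) (pullback Γ.src ψ) (pullback Γ.tgt ψ) :=
      ⟨rfl, by rw [integral_const, add_sub_cancel]⟩
    linear_combination weak _ _ ⟨ψ, interpolant⟩ - interpolant.inner_add_inner hb

theorem IsWeakDeriv.eq_smul_one (hf : Γ.IsWeakDeriv f 0) (hΓ : Γ.Connected) :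
    ∃ c : ℂ, f = c • one := by
  obtain ⟨φ, hφ⟩ := hf
  have pullback_eq : pullback Γ.tgt φ = pullback Γ.src φ := by simpa using hφ.right_eq
  obtain ⟨c, hc⟩ := hΓ.exists_forall_eq fun e => congrArg (· e) pullback_eq.symm
  refine ⟨c, ?_⟩
  rw [hφ.eq_const_add_volterra, map_zero, add_zero, one, ← map_smul]
  refine congrArg (const (X := EuclideanSpace ℂ E)) ?_
  ext e
  simp [hc]

/-- The square integrable functions that are derivatives of `H¹` functions on the metric graph. -/
def derivSubspace (Γ : Multigraph V E) : Submodule ℂ (L2 E) :=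
  (LinearMap.range (pullback Γ.tgt - pullback Γ.src)).comap
    (integral (X := EuclideanSpace ℂ E)).toLinearMap

theorem IsWeakDeriv.mem_derivSubspace (hf : Γ.IsWeakDeriv f h) : h ∈ Γ.derivSubspace := by
  obtain ⟨φ, hφ⟩ := hf
  exact ⟨φ, sub_eq_iff_eq_add'.2 hφ.right_eq⟩

instance completeSpace_derivSubspace (Γ : Multigraph V E) : CompleteSpace Γ.derivSubspace := by
  have isClosed : IsClosed (Γ.derivSubspace : Set (L2 E)) :=
    (Submodule.closed_of_finiteDimensional
      (LinearMap.range (pullback Γ.tgt - pullback Γ.src))).preimage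
      (integral (X := EuclideanSpace ℂ E)).continuous
  exact isClosed.completeSpace_coe

theorem exists_isCompactOperator_isWeakDeriv (Γ : Multigraph V E) :
    ∃ T : Γ.derivSubspace →L[ℂ] L2 E, IsCompactOperator T ∧ ∀ h, Γ.IsWeakDeriv (T h) h := by
  let coboundary : (V → ℂ) →ₗ[ℂ] EuclideanSpace ℂ E := pullback Γ.tgt - pullback Γ.src
  obtain ⟨potential, h_potential⟩ := coboundary.rangeRestrict.exists_rightInverse_of_surjective
    coboundary.range_rangeRestrict
  let jump : Γ.derivSubspace →L[ℂ] LinearMap.range coboundary :=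
    (integral (X := EuclideanSpace ℂ E) ∘L Γ.derivSubspace.subtypeL).codRestrict _ fun h => h.2
  let initial : Γ.derivSubspace →L[ℂ] EuclideanSpace ℂ E :=
    (pullback Γ.src ∘ₗ potential).toContinuousLinearMap ∘L jump
  refine ⟨const ∘L initial + volterra ∘L Γ.derivSubspace.subtypeL,
    ((isCompactOperator_of_locallyCompactSpace_dom initial).clm_comp const).add
      (isCompactOperator_volterra.comp_clm _), fun h => ⟨potential (jump h), rfl, ?_⟩⟩
  have : coboundary (potential (jump h)) = integral (h : L2 E) :=
    congrArg Subtype.val (LinearMap.congr_fun h_potential (jump h))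
  exact sub_eq_iff_eq_add'.1 this

theorem IsWeakDeriv.sub_equilibrium (hf : Γ.IsWeakDeriv f h) :
    Γ.IsWeakDeriv (f - equilibrium f) h := by
  rw [equilibrium_eq_starProjection, Submodule.starProjection_singleton]
  simpa using hf.sub ((isWeakDeriv_one Γ).smul _)

theorem Connected.exists_isCompactOperator_sub_equilibrium_eq (hΓ : Γ.Connected) :
    ∃ A : Γ.derivSubspace →L[ℂ] L2 E, IsCompactOperator A ∧
      (∀ h, Γ.IsWeakDeriv (A h) h ∧ ⟪one, A h⟫_ℂ = 0) ∧
      ∀ f h, (hf : Γ.IsWeakDeriv f h) → f - equilibrium f = A ⟨h, hf.mem_derivSubspace⟩ := by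
  obtain ⟨T, hT, hTw⟩ := Γ.exists_isCompactOperator_isWeakDeriv
  refine ⟨(ℂ ∙ one)ᗮ.starProjection ∘L T, hT.clm_comp (ℂ ∙ one)ᗮ.starProjection,
    fun h => ⟨?_, ?_⟩, fun f h hf => ?_⟩
  · rw [ContinuousLinearMap.comp_apply, ← sub_equilibrium_eq_starProjection]
    exact (hTw h).sub_equilibrium
  · exact Submodule.mem_orthogonal_singleton_iff_inner_right.1 <|
      Submodule.starProjection_apply_mem _ _
  · obtain ⟨c, hc⟩ := IsWeakDeriv.eq_smul_one
      (by simpa using hf.sub (hTw ⟨h, hf.mem_derivSubspace⟩)) hΓ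
    have : (ℂ ∙ one)ᗮ.starProjection (f - T ⟨h, hf.mem_derivSubspace⟩) = 0 := by
      rw [hc, ← sub_equilibrium_eq_starProjection, equilibrium_smul_one, sub_self]
    rw [sub_equilibrium_eq_starProjection]
    exact sub_eq_zero.1 ((map_sub _ _ _).symm.trans this)

/-- The Poincaré inequality with constant `lam`. -/
def SatisfiesPoincare (Γ : Multigraph V E) (lam : ℝ) : Prop :=
  ∀ f h, Γ.IsWeakDeriv f h → lam * ‖f - equilibrium f‖ ^ 2 ≤ ‖h‖ ^ 2

theorem exists_isWeakDeriv_sub_equilibrium_ne_zero [Nonempty E] (Γ : Multigraph V E) :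
    ∃ f h, Γ.IsWeakDeriv f h ∧ f - equilibrium f ≠ 0 := by
  obtain ⟨h, hh, h_ne⟩ :=
    exists_integral_eq_zero_forall_volterra_ne_const (X := EuclideanSpace ℂ E)
  exact ⟨volterra h, h, ⟨0, by simp, by simp [hh]⟩, fun h_sub =>
    h_ne _ (sub_eq_zero.1 h_sub)⟩

open scoped InnerProduct in
/-- The optimal Poincaré constant is `‖A‖⁻²` for the operator `A` that maps a derivative to its
primitive of mean zero, and it is an eigenvalue because the compact operator `A A†` has the
eigenvalue `‖A‖²`. -/
theorem Connected.exists_satisfiesPoincare_isCKEigenvalue [Nonempty E] (hΓ : Γ.Connected) :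
    ∃ lam > 0, Γ.SatisfiesPoincare lam ∧ Γ.IsCKEigenvalue lam := by
  obtain ⟨A, hA, hAw, sub_equilibrium_eq⟩ := hΓ.exists_isCompactOperator_sub_equilibrium_eq
  have hA₀ : A ≠ 0 := by
    rintro rfl
    obtain ⟨f, h, hf, hne⟩ := Γ.exists_isWeakDeriv_sub_equilibrium_ne_zero
    exact hne (sub_equilibrium_eq f h hf)
  have norm_sq_pos : 0 < ‖A‖ ^ 2 := sq_pos_of_ne_zero (A.opNorm_zero_iff.not.2 hA₀)
  obtain ⟨f, hf₀, hf⟩ := exists_comp_adjoint_eigenvector hA hA₀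
  let lam : ℝ := (‖A‖ ^ 2)⁻¹
  have f_eq : f = (lam : ℂ) • A ((A†) f) := by
    rw [hf, smul_smul, ← Complex.ofReal_mul, inv_mul_cancel₀ norm_sq_pos.ne', Complex.ofReal_one,
      one_smul]
  have hf_one : ⟪one, f⟫_ℂ = 0 := by rw [f_eq, inner_smul_right, (hAw _).2, mul_zero]
  have hfw : Γ.IsWeakDeriv f ((lam : ℂ) • (A†) f : Γ.derivSubspace) := by
    nth_rw 1 [f_eq]
    exact (hAw _).1.smul _
  refine ⟨lam, inv_pos.2 norm_sq_pos, fun k k' hk => ?_, f, hf₀, isCKLaplacian_iff.2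
    ⟨_, hfw, fun k k' hk => ?_⟩⟩
  · rw [sub_equilibrium_eq k k' hk, inv_mul_le_iff₀ norm_sq_pos, ← mul_pow]
    gcongr
    exact A.le_opNorm _
  · have inner_eq : ⟪k', ((A†) f : L2 E)⟫_ℂ = ⟪k, f⟫_ℂ :=
      calc ⟪k', ((A†) f : L2 E)⟫_ℂ = ⟪A ⟨k', hk.mem_derivSubspace⟩, f⟫_ℂ :=
            A.adjoint_inner_right ⟨k', hk.mem_derivSubspace⟩ f
        _ = ⟪k, f⟫_ℂ := by
            rw [← sub_equilibrium_eq k k' hk, equilibrium_eq_starProjection,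
              Submodule.starProjection_singleton, inner_sub_left, inner_smul_left, hf_one, mul_zero,
              sub_zero]
    rw [Submodule.coe_smul, inner_neg_right, inner_smul_right, inner_smul_right, inner_eq]

theorem IsCKLaplacian.smul (c : ℂ) (hf : Γ.IsCKLaplacian f g) :
    Γ.IsCKLaplacian (c • f) (c • g) := by
  obtain ⟨h, hw, weak⟩ := isCKLaplacian_iff.1 hf
  refine isCKLaplacian_iff.2 ⟨c • h, hw.smul c, fun k k' hk => ?_⟩
  rw [inner_smul_right, inner_smul_right, weak k k' hk, mul_neg]

theorem IsCKLaplacian.inner_one_eq_zero (hf : Γ.IsCKLaplacian f g) : ⟪one, g⟫_ℂ = 0 := by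
  obtain ⟨h, -, weak⟩ := isCKLaplacian_iff.1 hf
  rw [weak one 0 Γ.isWeakDeriv_one, inner_zero_left, neg_zero]

theorem IsCKLaplacian.equilibrium_eq_zero {lam : ℝ} (hlam : lam ≠ 0)
    (hf : Γ.IsCKLaplacian f (-((lam : ℂ) • f))) : equilibrium f = 0 := by
  rw [equilibrium_eq_zero_iff]
  have := hf.inner_one_eq_zero
  rw [inner_neg_right, inner_smul_right, neg_eq_zero, mul_eq_zero] at this
  exact this.resolve_left (Complex.ofReal_ne_zero.2 hlam)

theorem SatisfiesPoincare.mul_norm_sub_equilibrium_sq_le {lam : ℝ} (hΓ : Γ.SatisfiesPoincare lam)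
    (hf : Γ.IsCKLaplacian f g) :
    lam * ‖f - equilibrium f‖ ^ 2 ≤ -(⟪f - equilibrium f, g⟫_ℂ).re := by
  obtain ⟨h, hw, weak⟩ := isCKLaplacian_iff.1 hf
  rw [weak _ _ hw.sub_equilibrium, Complex.neg_re, neg_neg]
  exact (hΓ f h hw).trans_eq (inner_self_eq_norm_sq (𝕜 := ℂ) h).symm

theorem SatisfiesPoincare.le_of_isCKEigenvalue {lam l : ℝ} (hΓ : Γ.SatisfiesPoincare lam)
    (hl₀ : l ≠ 0) (hl : Γ.IsCKEigenvalue l) : lam ≤ l := by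
  obtain ⟨f, hf₀, hf⟩ := hl
  have le := hΓ.mul_norm_sub_equilibrium_sq_le hf
  have re_inner : (⟪f, -((l : ℂ) • f)⟫_ℂ).re = -(l * ‖f‖ ^ 2) := by
    rw [inner_neg_right, inner_smul_right, Complex.neg_re, Complex.re_ofReal_mul]
    exact congrArg (fun r => -(l * r)) (inner_self_eq_norm_sq (𝕜 := ℂ) f)
  rw [hf.equilibrium_eq_zero hl₀, sub_zero, re_inner, neg_neg] at le
  exact le_of_mul_le_mul_right le (by positivity)

theorem SatisfiesPoincare.isLowestNontrivialCKEigenvalue {lam : ℝ} (hΓ : Γ.SatisfiesPoincare lam)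
    (hlam₀ : lam ≠ 0) (hlam : Γ.IsCKEigenvalue lam) : Γ.IsLowestNontrivialCKEigenvalue lam :=
  ⟨⟨hlam₀, hlam⟩, fun _ hl => hΓ.le_of_isCKEigenvalue hl.1 hl.2⟩

theorem IsCKHeatSolution.equilibrium_eq {u : ℝ → L2 E} (hu : Γ.IsCKHeatSolution u) {t : ℝ}
    (ht : 0 ≤ t) : equilibrium (u t) = equilibrium (u 0) := by
  obtain ⟨cont, deriv⟩ := hu
  have deriv_inner (s : ℝ) (hs : 0 < s) :
      HasDerivAt (fun s => ⟪one, u s⟫_ℂ - ⟪one, u 0⟫_ℂ) 0 s := by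
    obtain ⟨g, hg, hug⟩ := deriv s hs
    refine (((hasDerivAt_const s one).inner ℂ hg).sub_const _).congr_deriv ?_
    rw [hug.inner_one_eq_zero, inner_zero_left, add_zero]
  have norm_le : ‖⟪one, u t⟫_ℂ - ⟪one, u 0⟫_ℂ‖ ≤ 0 := by
    simpa using norm_le_exp_mul_of_re_inner_le (lam := 0) (w' := fun _ => (0 : ℂ))
      ((continuousOn_const.inner cont).sub continuousOn_const) deriv_inner (by simp) ht
  rw [equilibrium_eq_starProjection, equilibrium_eq_starProjection,
    Submodule.starProjection_singleton, Submodule.starProjection_singleton,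
    sub_eq_zero.1 (norm_le_zero_iff.1 norm_le)]

theorem SatisfiesPoincare.heatConvergesAtRate {lam : ℝ} (hΓ : Γ.SatisfiesPoincare lam) :
    Γ.HeatConvergesAtRate lam := by
  refine ⟨1, fun u hu t ht => ?_⟩
  choose! g hg hug using hu.2
  rw [one_mul]
  refine norm_le_exp_mul_of_re_inner_le (w := fun s => u s - equilibrium (u 0))
    (hu.1.sub continuousOn_const) (fun s hs => (hg s hs).sub_const _) (fun s hs => ?_) ht
  rw [← hu.equilibrium_eq hs.le]
  linarith [hΓ.mul_norm_sub_equilibrium_sq_le (hug s hs)]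

theorem HeatConvergesAtRate.mono {α β : ℝ} (hβ : Γ.HeatConvergesAtRate β) (hαβ : α ≤ β) :
    Γ.HeatConvergesAtRate α := by
  obtain ⟨C, hC⟩ := hβ
  refine ⟨max C 0, fun u hu t ht => (hC u hu t ht).trans ?_⟩
  gcongr
  exact le_max_left _ _

theorem IsCKLaplacian.isCKHeatSolution_exp_smul {lam : ℝ}
    (hf : Γ.IsCKLaplacian f (-((lam : ℂ) • f))) :
    Γ.IsCKHeatSolution fun t => ((Real.exp (-lam * t) : ℝ) : ℂ) • f := by
  have deriv (t : ℝ) : HasDerivAt (fun t => ((Real.exp (-lam * t) : ℝ) : ℂ) • f)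
      (((Real.exp (-lam * t) : ℝ) : ℂ) • (-((lam : ℂ) • f))) t := by
    have deriv_exp : HasDerivAt (fun t => Real.exp (-lam * t)) (Real.exp (-lam * t) * -lam) t := by
      simpa using ((hasDerivAt_id t).const_mul (-lam)).exp
    refine (deriv_exp.ofReal_comp.smul_const f).congr_deriv ?_
    rw [← neg_smul, smul_smul, Complex.ofReal_mul, Complex.ofReal_neg]
  exact ⟨fun t _ => (deriv t).continuousAt.continuousWithinAt,
    fun t _ => ⟨_, deriv t, hf.smul _⟩⟩

theorem HeatConvergesAtRate.le_of_isCKEigenvalue {α lam : ℝ} (hα : Γ.HeatConvergesAtRate α)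
    (hlam₀ : lam ≠ 0) (hlam : Γ.IsCKEigenvalue lam) : α ≤ lam := by
  obtain ⟨f, hf₀, hf⟩ := hlam
  obtain ⟨C, hC⟩ := hα
  have exp_le (t : ℝ) (ht : 0 ≤ t) : Real.exp ((α - lam) * t) ≤ C := by
    have le := hC _ hf.isCKHeatSolution_exp_smul t ht
    simp only [mul_zero, Real.exp_zero, Complex.ofReal_one, one_smul,
      hf.equilibrium_eq_zero hlam₀, sub_zero, norm_smul, Complex.norm_real, Real.norm_eq_abs,
      Real.abs_exp] at le
    calc Real.exp ((α - lam) * t) = Real.exp (-lam * t) / Real.exp (-α * t) := by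
          rw [← Real.exp_sub]; ring_nf
      _ ≤ C := (div_le_iff₀ (Real.exp_pos _)).2 (le_of_mul_le_mul_right le (norm_pos_iff.2 hf₀))
  by_contra! hlt
  have tendsto : Filter.Tendsto (fun t => Real.exp ((α - lam) * t)) Filter.atTop Filter.atTop :=
    Real.tendsto_exp_atTop.comp (Filter.tendsto_id.const_mul_atTop (sub_pos.2 hlt))
  obtain ⟨t, ht, hCt⟩ :=
    ((Filter.eventually_ge_atTop 0).and (tendsto.eventually_gt_atTop C)).exists
  exact hCt.not_ge (exp_le t ht)

theorem norm_sub_equilibrium_le (f : L2 E) (c : ℂ) : ‖f - equilibrium f‖ ≤ ‖f - c • one‖ := by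
  rw [equilibrium_eq_starProjection, Submodule.starProjection_minimal]
  exact ciInf_le (f := fun x : (ℂ ∙ (one : L2 E)) => ‖f - x‖)
    ⟨0, Set.forall_mem_range.2 fun _ => norm_nonneg _⟩
    ⟨c • one, Submodule.smul_mem _ c (Submodule.mem_span_singleton_self one)⟩

variable {V₁ E₁ V₂ E₂ : Type*} [Fintype E₁] [Fintype E₂] {Γ₁ : Multigraph V₁ E₁}
  {Γ₂ : Multigraph V₂ E₂}

/-- The lift is the composition with the contraction, extended by constants to the discarded
edges. -/
theorem IsVertexContraction.exists_lift (hΓ : Γ₁.IsVertexContraction Γ₂) {f h : L2 E₂}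
    (hf : Γ₂.IsWeakDeriv f h) : ∃ F H : L2 E₁, Γ₁.IsWeakDeriv F H ∧ ‖H‖ = ‖h‖ ∧
      ∀ c : ℂ, ‖f - c • one‖ ≤ ‖F - c • one‖ := by
  obtain ⟨p, i, -, hi, kept, discarded⟩ := hΓ
  obtain ⟨φ, hφ⟩ := hf
  have exists_kept (e : E₂) : ∃ F H : UnitL2 ℂ,
      HasWeakDeriv F H (φ (p (Γ₁.src (i e)))) (φ (p (Γ₁.tgt (i e)))) ∧
      ‖H‖ = ‖edge e h‖ ∧ ∀ c, ‖F - const c‖ = ‖edge e f - const c‖ :=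
    (hasWeakDeriv_iff_forall_edge.1 hφ e).exists_of_endpoints <| (kept e).imp
      (fun h => ⟨congrArg φ h.1, congrArg φ h.2⟩) fun h => ⟨congrArg φ h.1, congrArg φ h.2⟩
  choose F₀ H₀ hF₀ norm_H₀ norm_F₀ using exists_kept
  obtain ⟨F, hF⟩ := exists_forall_edge_eq (Function.extend i F₀ fun e => const (φ (p (Γ₁.src e))))
  obtain ⟨H, hH⟩ := exists_forall_edge_eq (Function.extend i H₀ 0)
  refine ⟨F, H, ⟨φ ∘ p, hasWeakDeriv_iff_forall_edge.2 fun e => ?_⟩, ?_, fun c => ?_⟩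
  · rw [hF, hH]
    by_cases he : ∃ e', i e' = e
    · obtain ⟨e, rfl⟩ := he
      rw [hi.extend_apply, hi.extend_apply]
      exact hF₀ e
    · rw [Function.extend_apply' _ _ _ he, Function.extend_apply' _ _ _ he, pullback_apply,
        pullback_apply, Function.comp_apply, Function.comp_apply, ← (discarded e he).2]
      exact hasWeakDeriv_const _
  · refine (sq_eq_sq₀ (norm_nonneg _) (norm_nonneg _)).1 ?_
    simp only [norm_sq_eq_sum_norm_sq_edge, hH]
    refine (Fintype.sum_of_injective i hi _ _ (fun e he => ?_) fun e => ?_).symm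
    · rw [Function.extend_apply' _ _ _ he, Pi.zero_apply, norm_zero, sq, zero_mul]
    · rw [hi.extend_apply, norm_H₀]
  · refine le_of_sq_le_sq ?_ (norm_nonneg _)
    simp only [norm_sq_eq_sum_norm_sq_edge, map_sub, hF, edge_smul_one]
    calc ∑ e, ‖edge e f - const c‖ ^ 2
        = ∑ e ∈ Finset.univ.map ⟨i, hi⟩,
            ‖Function.extend i F₀ (fun e => const (φ (p (Γ₁.src e)))) e - const c‖ ^ 2 := by
          simp [hi.extend_apply, norm_F₀]
      _ ≤ _ := Finset.sum_le_sum_of_subset_of_nonneg (Finset.subset_univ _) fun _ _ _ => sq_nonneg _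

theorem IsVertexContraction.satisfiesPoincare (hΓ : Γ₁.IsVertexContraction Γ₂) {lam : ℝ}
    (hlam : 0 ≤ lam) (h₁ : Γ₁.SatisfiesPoincare lam) : Γ₂.SatisfiesPoincare lam := by
  intro f h hf
  obtain ⟨F, H, hFH, norm_eq, le⟩ := hΓ.exists_lift hf
  obtain ⟨c, hc⟩ : ∃ c : ℂ, equilibrium F = c • one :=
    ⟨_, by rw [equilibrium_eq_starProjection, Submodule.starProjection_singleton]⟩
  calc lam * ‖f - equilibrium f‖ ^ 2 ≤ lam * ‖F - equilibrium F‖ ^ 2 := by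
        gcongr
        exact hc ▸ (norm_sub_equilibrium_le f c).trans (le c)
    _ ≤ ‖h‖ ^ 2 := norm_eq ▸ h₁ F H hFH

end Multigraph

end Graph

end CKHeat

end

theorem proposition3p4 {V₁ E₁ V₂ E₂ : Type*} [Fintype V₁] [Fintype E₁] [Fintype V₂] [Fintype E₂]
    [Nonempty E₂] (Γ₁ : CKHeat.Multigraph V₁ E₁) (Γ₂ : CKHeat.Multigraph V₂ E₂)
    (h₁ : Γ₁.Connected) (h₂ : Γ₂.Connected) (h : Γ₁.IsVertexContraction Γ₂) :
    ∃ lam₁ lam₂ : ℝ,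
      Γ₁.IsLowestNontrivialCKEigenvalue lam₁ ∧ Γ₂.IsLowestNontrivialCKEigenvalue lam₂ ∧
      0 < lam₁ ∧ lam₁ ≤ lam₂ ∧
      IsGreatest {α : ℝ | Γ₁.HeatConvergesAtRate α} lam₁ ∧
      IsGreatest {α : ℝ | Γ₂.HeatConvergesAtRate α} lam₂ ∧
      (∀ α : ℝ, Γ₁.HeatConvergesAtRate α → Γ₂.HeatConvergesAtRate α) := by
  have : Nonempty E₁ := ‹Nonempty E₂›.map h.choose_spec.choose
  obtain ⟨lam₁, pos₁, poincare₁, eigen₁⟩ := h₁.exists_satisfiesPoincare_isCKEigenvalue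
  obtain ⟨lam₂, pos₂, poincare₂, eigen₂⟩ := h₂.exists_satisfiesPoincare_isCKEigenvalue
  have lam_le : lam₁ ≤ lam₂ :=
    (h.satisfiesPoincare pos₁.le poincare₁).le_of_isCKEigenvalue pos₂.ne' eigen₂
  have rate_le₁ {α : ℝ} (hα : Γ₁.HeatConvergesAtRate α) : α ≤ lam₁ :=
    hα.le_of_isCKEigenvalue pos₁.ne' eigen₁
  have rate_le₂ {α : ℝ} (hα : Γ₂.HeatConvergesAtRate α) : α ≤ lam₂ :=
    hα.le_of_isCKEigenvalue pos₂.ne' eigen₂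
  exact ⟨lam₁, lam₂, poincare₁.isLowestNontrivialCKEigenvalue pos₁.ne' eigen₁,
    poincare₂.isLowestNontrivialCKEigenvalue pos₂.ne' eigen₂, pos₁, lam_le,
    ⟨poincare₁.heatConvergesAtRate, fun _ => rate_le₁⟩,
    ⟨poincare₂.heatConvergesAtRate, fun _ => rate_le₂⟩,
    fun _ hα => poincare₂.heatConvergesAtRate.mono ((rate_le₁ hα).trans lam_le)⟩
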